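/- Let $n,m,t\ge 1$ be integers. For $p\ge 1$ let $Z_p=\{1,\dots,p\}$. An $n\times m$ Latin hypercube is an array each of whose columns is a permutation of $Z_n$; it is a (random) ordinary Latin hypercube if its columns are independent uniform random permutations of $Z_n$. **The algorithm.** The sliced Latin hypercube (SLH) algorithm generates $n\times m$ random matrices $D_1,\dots,D_t$ as follows. (1) Generate $t$ independent ordinary Latin hypercubes $A_1,\dots,A_t$ of size $n\times m$. (2) For each column $k\le m$ and each symbol $\ell\in Z_n$, independently of each other and of step (1), replace the $t$ occurrences of $\ell$ in the $k$th columns of $A_1,\dots,A_t$ by a uniform random permutation of $\{t(\ell-1)+1,\dots,t(\ell-1)+t\}$ (one element for each $A_r$); call the resulting entries $a_{r,ik}$. (3) The $(i,k)$ entry of $D_r$ is $\xi_{r,ik}=(a_{r,ik}-\gamma_{r,ik})/(nt)$, where the $\gamma_{r,ik}$ are independent, uniform on $[0,1)$, and independent of the $a_{r,ik}$. **Monotonicity.** Let $v_n:(0,1]^{n\times m}\to\mathbb R$. For a Latin hypercube $B=(b_{ik})$ and $\Delta=(\delta_{\ell k})\in[0,1)^{n\times m}$ put $H(\Delta;B)=v_n\big((B-\Theta)/n\big)$,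 where $\Theta=(\theta_{ik})$ and $\theta_{ik}=\delta_{b_{ik}k}$. The function $v_n$ is called monotonic if for each $(\ell,k)$ either $H(\Delta;B)$ is nondecreasing in $\delta_{\ell k}$ for every Latin hypercube $B$ and all values of the other entries of $\Delta$, or $H(\Delta;B)$ is nonincreasing in $\delta_{\ell k}$ for every Latin hypercube $B$ and all values of the other entries of $\Delta$. **Statement.** Let $D_1,\dots,D_t$ be generated by the SLH algorithm. Let $v_n$ be monotonic, and integrable with respect to the law of each $D_r$. Then for all $r\ne s$ the product $v_n(D_r)v_n(D_s)$ is integrable and $$\mathbb E[v_n(D_r)\,v_n(D_s)]\le \mathbb E[v_n(D_r)]\;\mathbb E[v_n(D_s)].$$ In particular, this holds when $v_n(D)=\min_{x\in X}\frac1n\sum_{i=1}^n G(x,\xi_i)$ is the optimal value of the sample-average approximation problem defined by the batch $D\in(0,1]^{n\times m}$ with rows $\xi_1,\dots,\xi_n$, for $X\subset\mathbb R^p$ and $G:\mathbb R^p\times\mathbb R^m\to\mathbb R$ such that this minimum is attained for every $D\in(0,1]^{n\times m}$, provided that this $v_n$ is monotonic and integrable as above: the optimal values of distinct batches are not positively correlated.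 -/

import Mathlib

open MeasureTheory ProbabilityTheory Set

/-- A batch of `n` scenarios in dimension `m`: row `i` is the `i`-th scenario. -/
abbrev Batch (n m : ℕ) : Type := Fin n → Fin m → ℝ

/-- The set `(0,1]^(n × m)` of batches. -/
def unitBatches (n m : ℕ) : Set (Batch n m) :=
  {D | ∀ i k, D i k ∈ Ioc (0 : ℝ) 1}

/-- The finite set of permutations carries the discrete σ-algebra. -/
instance permMeasurableSpace (p : ℕ) : MeasurableSpace (Equiv.Perm (Fin p)) := ⊤

instance permDiscreteMeasurableSpace (p : ℕ) :
    DiscreteMeasurableSpace (Equiv.Perm (Fin p)) := ⟨fun _ => trivial⟩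

/-- The law of a uniform random permutation of `p` objects. -/
noncomputable def uniformPerm (p : ℕ) : Measure (Equiv.Perm (Fin p)) :=
  (PMF.uniformOfFintype (Equiv.Perm (Fin p))).toMeasure

instance uniformPerm_isProbabilityMeasure (p : ℕ) : IsProbabilityMeasure (uniformPerm p) := by
  unfold uniformPerm; infer_instance

/-- The uniform distribution on `[0,1)`. -/
noncomputable def uniformIco : Measure ℝ := volume.restrict (Ico (0 : ℝ) 1)

instance uniformIco_isProbabilityMeasure : IsProbabilityMeasure uniformIco :=
  ⟨by simp [uniformIco]⟩

/-- The random choices made by the sliced Latin hypercube algorithm. For `c : SLHChoices n m t`: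
* `c.1 r k` is the permutation in the `k`-th column of the `r`-th ordinary Latin hypercube
  (the symbol in row `i` is `(c.1 r k i : ℕ) + 1`, an element of `{1, …, n}`);
* `c.2.1 k l` is the permutation that replaces, in the `k`-th columns of all the hypercubes,
  the `t` occurrences of the symbol `l + 1`;
* `c.2.2 r i k` is the number `γ` that shifts entry `(i, k)` of the `r`-th batch. -/
abbrev SLHChoices (n m t : ℕ) : Type :=
  (Fin t → Fin m → Equiv.Perm (Fin n)) ×
    (Fin m → Fin n → Equiv.Perm (Fin t)) ×
      (Fin t → Fin n → Fin m → ℝ)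

/-- All the choices are mutually independent, the permutations are uniform and the shifts are
uniform on `[0,1)`. -/
noncomputable def slhChoicesLaw (n m t : ℕ) : Measure (SLHChoices n m t) :=
  (Measure.pi fun _ : Fin t => Measure.pi fun _ : Fin m => uniformPerm n).prod
    ((Measure.pi fun _ : Fin m => Measure.pi fun _ : Fin n => uniformPerm t).prod
      (Measure.pi fun _ : Fin t => Measure.pi fun _ : Fin n => Measure.pi fun _ : Fin m =>
        uniformIco))

instance slhChoicesLaw_isProbabilityMeasure (n m t : ℕ) :
    IsProbabilityMeasure (slhChoicesLaw n m t) := by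
  unfold slhChoicesLaw; infer_instance

/-- The entry `(i, k)` of the `r`-th Latin hypercube after the replacement step: the symbol
`l + 1` of the `r`-th hypercube becomes the `r`-th term of a permutation of
`{t * l + 1, …, t * l + t}`. -/
def slhEntry {n m t : ℕ} (τ : Fin t → Fin m → Equiv.Perm (Fin n))
    (π : Fin m → Fin n → Equiv.Perm (Fin t)) (r : Fin t) (i : Fin n) (k : Fin m) : ℕ :=
  t * (τ r k i : ℕ) + (π k (τ r k i) r : ℕ) + 1

/-- The batches `D_1, …, D_t` that the algorithm returns, with entries `(a - γ) / (n t)`. -/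
noncomputable def slhBatches (n m t : ℕ) (c : SLHChoices n m t) : Fin t → Batch n m :=
  fun r i k => ((slhEntry c.1 c.2.1 r i k : ℝ) - c.2.2 r i k) / ((n : ℝ) * (t : ℝ))

theorem measurable_slhEntry_aux {n t : ℕ} (r : Fin t) (i : Fin n) :
    Measurable fun q : Equiv.Perm (Fin n) × (Fin n → Equiv.Perm (Fin t)) =>
      ((t * (q.1 i : ℕ) + (q.2 (q.1 i) r : ℕ) + 1 : ℕ) : ℝ) :=
  Measurable.of_discrete

theorem measurable_slhEntry {n m t : ℕ} (r : Fin t) (i : Fin n) (k : Fin m) :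
    Measurable fun c : SLHChoices n m t => (slhEntry c.1 c.2.1 r i k : ℝ) := by
  have h₁ : Measurable fun c : SLHChoices n m t => c.1 r k := by fun_prop
  have h₂ : Measurable fun c : SLHChoices n m t => c.2.1 k := by fun_prop
  have h := (measurable_slhEntry_aux r i).comp (h₁.prodMk h₂)
  exact h

theorem measurable_slhBatches (n m t : ℕ) : Measurable (slhBatches n m t) := by
  unfold slhBatches
  refine measurable_pi_iff.2 fun r => measurable_pi_iff.2 fun i => measurable_pi_iff.2 fun k => ?_
  have h : Measurable fun c : SLHChoices n m t => c.2.2 r i k :=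
    (measurable_pi_apply k).comp ((measurable_pi_apply i).comp ((measurable_pi_apply r).comp
      (measurable_snd.comp measurable_snd)))
  exact ((measurable_slhEntry r i k).sub h).div_const _

/-- The joint law of the batches `D_1, …, D_t` of a sliced Latin hypercube design. -/
noncomputable def slhLaw (n m t : ℕ) : Measure (Fin t → Batch n m) :=
  (slhChoicesLaw n m t).map (slhBatches n m t)

instance slhLaw_isProbabilityMeasure (n m t : ℕ) : IsProbabilityMeasure (slhLaw n m t) :=
  Measure.isProbabilityMeasure_map (measurable_slhBatches n m t).aemeasurable

/-- `H(Δ; B) = v ((B - Θ) / n)`. The Latin hypercube `B` is given by its column permutations `τ`: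
`b i k = (τ k i : ℕ) + 1`; and `Θ` is obtained from `Δ` by `θ i k = Δ (b i k) k`. -/
noncomputable def levelForm {n m : ℕ} (v : Batch n m → ℝ) (τ : Fin m → Equiv.Perm (Fin n))
    (Δ : Batch n m) : ℝ :=
  v fun i k => (((τ k i : ℕ) : ℝ) + 1 - Δ (τ k i) k) / (n : ℝ)

/-- `v` is monotonic: for each `(l, k)`, either `H(Δ; B)` is nondecreasing in `Δ l k` for every
Latin hypercube `B`, or it is nonincreasing in `Δ l k` for every Latin hypercube `B`
(the entries of `Δ` range over `[0,1)`). -/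
def BatchMonotonic {n m : ℕ} (v : Batch n m → ℝ) : Prop :=
  ∀ (l : Fin n) (k : Fin m),
    (∀ (τ : Fin m → Equiv.Perm (Fin n)) (Δ Δ' : Batch n m),
      (∀ i j, Δ i j ∈ Ico (0 : ℝ) 1) → (∀ i j, Δ' i j ∈ Ico (0 : ℝ) 1) →
      (∀ i j, (i, j) ≠ (l, k) → Δ i j = Δ' i j) → Δ l k ≤ Δ' l k →
      levelForm v τ Δ ≤ levelForm v τ Δ') ∨
    (∀ (τ : Fin m → Equiv.Perm (Fin n)) (Δ Δ' : Batch n m),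
      (∀ i j, Δ i j ∈ Ico (0 : ℝ) 1) → (∀ i j, Δ' i j ∈ Ico (0 : ℝ) 1) →
      (∀ i j, (i, j) ≠ (l, k) → Δ i j = Δ' i j) → Δ l k ≤ Δ' l k →
      levelForm v τ Δ' ≤ levelForm v τ Δ)

/-- The sample-average approximation `x ↦ (1/n) ∑ i, G (x, ξ_i)` for the batch `D` with
rows `ξ_i`. -/
noncomputable def saaObjective {n m p : ℕ}
    (G : EuclideanSpace ℝ (Fin p) → (Fin m → ℝ) → ℝ) (D : Batch n m)
    (x : EuclideanSpace ℝ (Fin p)) : ℝ :=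
  (1 / (n : ℝ)) * ∑ i, G x (D i)

/-- The optimal value `v_n(D)` of the sample-average approximation problem over the feasible
set `X`. -/
noncomputable def saaValue {n m p : ℕ} (X : Set (EuclideanSpace ℝ (Fin p)))
    (G : EuclideanSpace ℝ (Fin p) → (Fin m → ℝ) → ℝ) (D : Batch n m) : ℝ :=
  sInf (saaObjective G D '' X)

/-!
Fix two slices `r ≠ s`. Writing `p k l = π k l r` for the position that slice `r` receives at level
`l` of column `k`, the batch `D_r` is `slicedBatch τ_r p γ_r`, and `v (D_r)` is
`H(Δ; τ_r)` for a matrix `Δ` of level shifts (`sliceShift`) whose `(l, k)` entry lies in `[0, 1)`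
and decreases with `p k l` (`apply_slicedBatch`).

Given the replacement permutations `π`, the batches `D_r` and `D_s` are independent, since they use
different column permutations and different shifts. Averaging over these leaves
`E[v(D_r) v(D_s)] = E[h(π r) h(π s)]` and `E[v(D_r)] = E[h(π r)]`, where `h = sliceMean v` depends
on the discrete positions only (`integral_mul_slhBatches`, `integral_apply_slhBatches`). The
conditional expectations are finite because `τ` and `π` range over finite sets, all of whose points
have positive probability (`integrable_apply_slicedBatch`); this also makes the product integrable.

Monotonicity of `v` makes `h` monotone or antitone in each position separately
(`comonotone_sliceMean`). For a single uniform permutation `σ`, the pair `(σ r, σ s)` is uniform on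
the pairs of distinct values, and
`E[f(σ r) g(σ s)] ≤ E[f(σ r)] E[g(σ s)]` for `f`, `g` monotone in the same direction is a form of
Chebyshev's sum inequality (`card_mul_sum_perm_mul_le`). Summing out one coordinate of an
independent family of permutations preserves coordinatewise monotonicity, so induction on the
number of coordinates gives the same inequality for the family
(`card_pow_mul_sum_perm_family_le`), hence for `h`.
-/

/-! ### Negative dependence of two values of a random permutation -/

/-- In each variable separately, with the others fixed, `f` and `g` are both nondecreasing or both
nonincreasing; the direction may depend on the variable, but not on the values of the others. -/
def Comonotone {ι β : Type*} [LE β] (f g : (ι → β) → ℝ) : Prop :=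
  ∀ i, (∀ x y : ι → β, (∀ j, j ≠ i → x j = y j) → x i ≤ y i → f x ≤ f y ∧ g x ≤ g y) ∨
    (∀ x y : ι → β, (∀ j, j ≠ i → x j = y j) → x i ≤ y i → f y ≤ f x ∧ g y ≤ g x)

theorem exists_perm_map_pair {α : Type*} [DecidableEq α] {r s r' s' : α} (h : r ≠ s)
    (h' : r' ≠ s') : ∃ ρ : Equiv.Perm α, ρ r = r' ∧ ρ s = s' := by
  refine ⟨Equiv.swap (Equiv.swap r r' s) s' * Equiv.swap r r', ?_, ?_⟩
  · have : r' ≠ Equiv.swap r r' s := by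
      intro e
      apply h
      apply (Equiv.swap r r').injective
      rw [Equiv.swap_apply_left, ← e]
    rw [Equiv.Perm.mul_apply, Equiv.swap_apply_left, Equiv.swap_apply_of_ne_of_ne this h']
  · rw [Equiv.Perm.mul_apply, Equiv.swap_apply_left]

theorem sum_perm_apply_pair {α : Type*} [Fintype α] [DecidableEq α] (F : α → α → ℝ)
    {r s r' s' : α} (h : r ≠ s) (h' : r' ≠ s') :
    ∑ σ : Equiv.Perm α, F (σ r') (σ s') = ∑ σ : Equiv.Perm α, F (σ r) (σ s) := by
  obtain ⟨ρ, rfl, rfl⟩ := exists_perm_map_pair h h'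
  exact Fintype.sum_equiv (Equiv.mulRight ρ) _ _ fun σ => by simp

/-- A value of a uniform random permutation is uniformly distributed. -/
theorem card_mul_sum_perm_apply {α : Type*} [Fintype α] [DecidableEq α] (f : α → ℝ) (r : α) :
    (Fintype.card α : ℝ) * ∑ σ : Equiv.Perm α, f (σ r) =
      Fintype.card (Equiv.Perm α) * ∑ a, f a := by
  have h : ∀ r', ∑ σ : Equiv.Perm α, f (σ r') = ∑ σ : Equiv.Perm α, f (σ r) := fun r' =>
    Fintype.sum_equiv (Equiv.mulRight (Equiv.swap r r')) _ _ fun σ => by simp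
  calc (Fintype.card α : ℝ) * ∑ σ : Equiv.Perm α, f (σ r)
      = ∑ r', ∑ σ : Equiv.Perm α, f (σ r') := by simp [h]
    _ = ∑ σ : Equiv.Perm α, ∑ r', f (σ r') := Finset.sum_comm
    _ = _ := by simp [Equiv.sum_comp]

/-- Values of a uniform random permutation at two distinct points are not positively correlated,
also after functions monotone in the same direction have been applied to them. -/
theorem card_mul_sum_perm_mul_le {α : Type*} [Fintype α] [DecidableEq α] {f g : α → ℝ}
    (hfg : Monovary f g) {r s : α} (hrs : r ≠ s) :
    (Fintype.card (Equiv.Perm α) : ℝ) * ∑ σ : Equiv.Perm α, f (σ r) * g (σ s) ≤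
      (∑ σ : Equiv.Perm α, f (σ r)) * ∑ σ : Equiv.Perm α, g (σ s) := by
  set S := ∑ σ : Equiv.Perm α, f (σ r) * g (σ s) with hS
  set N : ℝ := (Fintype.card (Equiv.Perm α) : ℝ) with hN
  set q : ℝ := (Fintype.card α : ℝ) with hq
  have hq1 : 1 < q := by
    rw [hq]; exact_mod_cast Fintype.one_lt_card_iff.2 ⟨r, s, hrs⟩
  have hN0 : 0 < N := by rw [hN]; exact_mod_cast Fintype.card_pos
  -- Summing over all ordered pairs of positions: the diagonal pairs contribute `∑ f g`, all the
  -- others contribute the same amount `S`.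
  have hsum : q * (q - 1) * S + N * ∑ a, f a * g a = N * ((∑ a, f a) * ∑ a, g a) := by
    have hrow : ∀ r', ∑ s', ∑ σ : Equiv.Perm α, f (σ r') * g (σ s') =
        (q - 1) * S + ∑ σ : Equiv.Perm α, f (σ r') * g (σ r') := by
      intro r'
      rw [← Finset.sum_erase_add _ _ (Finset.mem_univ r')]
      congr 1
      rw [Finset.sum_congr rfl fun s' hs' =>
        sum_perm_apply_pair (fun a b => f a * g b) hrs (Finset.ne_of_mem_erase hs').symm]
      rw [Finset.sum_const, Finset.card_erase_of_mem (Finset.mem_univ _), nsmul_eq_mul,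
        Finset.card_univ, Nat.cast_pred (Fintype.card_pos_iff.2 ⟨r⟩)]
    have hall : ∑ r', ∑ s', ∑ σ : Equiv.Perm α, f (σ r') * g (σ s') =
        N * ((∑ a, f a) * ∑ a, g a) := by
      calc ∑ r', ∑ s', ∑ σ : Equiv.Perm α, f (σ r') * g (σ s')
          = ∑ σ : Equiv.Perm α, ∑ r', ∑ s', f (σ r') * g (σ s') := by
            rw [Finset.sum_comm]
            refine (Finset.sum_congr rfl fun _ _ => Finset.sum_comm).trans ?_
            rw [Finset.sum_comm]
            exact Finset.sum_congr rfl fun _ _ => Finset.sum_comm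
        _ = ∑ σ : Equiv.Perm α, (∑ a, f a) * ∑ a, g a := by
            refine Finset.sum_congr rfl fun σ _ => ?_
            rw [← Finset.sum_mul_sum, Equiv.sum_comp σ f, Equiv.sum_comp σ g]
        _ = _ := by simp [hN]
    rw [← hall, Finset.sum_congr rfl fun r' _ => hrow r', Finset.sum_add_distrib, Finset.sum_comm,
      Finset.sum_congr rfl fun σ _ => Equiv.sum_comp σ fun a => f a * g a]
    simp [hN, hq]
    ring
  have hcheb : (∑ a, f a) * ∑ a, g a ≤ q * ∑ a, f a * g a := hfg.sum_mul_sum_le_card_mul_sum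
  have h₁ := card_mul_sum_perm_apply f r
  have h₂ := card_mul_sum_perm_apply g s
  rw [← hN, ← hq] at h₁ h₂
  -- Both sides are expressed through the plain sums of `f` and `g`; the inequality left is
  -- Chebyshev's.
  have key : (q ^ 2 * (q - 1)) * (N * S) ≤
      (q ^ 2 * (q - 1)) * ((∑ σ : Equiv.Perm α, f (σ r)) * ∑ σ : Equiv.Perm α, g (σ s)) := by
    calc (q ^ 2 * (q - 1)) * (N * S)
        = N ^ 2 * (q * ((∑ a, f a) * ∑ a, g a) - q * ∑ a, f a * g a) := by
          linear_combination q * N * hsum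
      _ ≤ N ^ 2 * ((q - 1) * ((∑ a, f a) * ∑ a, g a)) := by
          gcongr
          linarith
      _ = (q - 1) * ((q * ∑ σ : Equiv.Perm α, f (σ r)) *
            (q * ∑ σ : Equiv.Perm α, g (σ s))) := by rw [h₁, h₂]; ring
      _ = _ := by ring
  exact le_of_mul_le_mul_left key (by have : 0 < q - 1 := by linarith
                                      positivity)

theorem sum_perm_tuple_succ {α : Type*} [Fintype α] [DecidableEq α] {N : ℕ}
    (F : (Fin (N + 1) → Equiv.Perm α) → ℝ) :
    ∑ π, F π = ∑ π : Fin N → Equiv.Perm α, ∑ σ : Equiv.Perm α, F (Fin.cons σ π) := by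
  rw [← (Fin.consEquiv fun _ => Equiv.Perm α).sum_comp, Fintype.sum_prod_type_right]
  rfl

/-- The inequality for a tuple of independent permutations, by induction on its length. The step
sums out coordinate `0`, which leaves comonotone functions of the other coordinates. -/
theorem card_pow_mul_sum_tuple_mul_le {t : ℕ} {r s : Fin t} (hrs : r ≠ s) (N : ℕ) :
    ∀ {f g : (Fin N → Fin t) → ℝ}, Comonotone f g →
      (Fintype.card (Equiv.Perm (Fin t)) : ℝ) ^ N *
          ∑ π : Fin N → Equiv.Perm (Fin t), f (fun i => π i r) * g (fun i => π i s) ≤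
        (∑ π : Fin N → Equiv.Perm (Fin t), f fun i => π i r) *
          ∑ π : Fin N → Equiv.Perm (Fin t), g fun i => π i s := by
  induction N with
  | zero =>
    intro f g _
    simp [Subsingleton.elim _ (default : Fin 0 → Fin t)]
  | succ N ih =>
    intro f g hfg
    have hcons : ∀ (σ : Equiv.Perm (Fin t)) (π : Fin N → Equiv.Perm (Fin t)) (a : Fin t),
        (fun i => (Fin.cons σ π : Fin (N + 1) → Equiv.Perm (Fin t)) i a) =
          Fin.cons (σ a) fun i => π i a := by
      intro σ π a
      funext i
      refine Fin.cases ?_ (fun j => ?_) i <;> simp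
    simp only [sum_perm_tuple_succ, hcons]
    have hF : Comonotone
        (fun x : Fin N → Fin t => ∑ σ : Equiv.Perm (Fin t), f (Fin.cons (σ r) x))
        (fun x : Fin N → Fin t => ∑ σ : Equiv.Perm (Fin t), g (Fin.cons (σ s) x)) := by
      have hagree : ∀ (i : Fin N) (x y : Fin N → Fin t) (a : Fin t), (∀ j, j ≠ i → x j = y j) →
          ∀ j, j ≠ i.succ → (Fin.cons a x : Fin (N + 1) → Fin t) j =
            (Fin.cons a y : Fin (N + 1) → Fin t) j := by
        intro i x y a h j
        refine Fin.cases (fun _ => rfl) (fun j hj => ?_) j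
        simpa using h j fun e => hj (by rw [e])
      intro i
      rcases hfg i.succ with h | h
      · refine Or.inl fun x y hxy hi => ⟨?_, ?_⟩
        · exact Finset.sum_le_sum fun σ _ => (h _ _ (hagree i x y _ hxy) (by simpa using hi)).1
        · exact Finset.sum_le_sum fun σ _ => (h _ _ (hagree i x y _ hxy) (by simpa using hi)).2
      · refine Or.inr fun x y hxy hi => ⟨?_, ?_⟩
        · exact Finset.sum_le_sum fun σ _ => (h _ _ (hagree i x y _ hxy) (by simpa using hi)).1
        · exact Finset.sum_le_sum fun σ _ => (h _ _ (hagree i x y _ hxy) (by simpa using hi)).2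
    have hmono : ∀ x y : Fin N → Fin t,
        Monovary (fun a : Fin t => f (Fin.cons a x)) fun a => g (Fin.cons a y) := by
      have hagree : ∀ (x : Fin N → Fin t) (a b : Fin t), ∀ j, j ≠ 0 →
          (Fin.cons a x : Fin (N + 1) → Fin t) j = (Fin.cons b x : Fin (N + 1) → Fin t) j := by
        intro x a b j
        refine Fin.cases (fun h => absurd rfl h) (fun j _ => by simp) j
      intro x y
      rcases hfg 0 with h | h
      · exact Monotone.monovary (fun a b hab => (h _ _ (hagree x a b) (by simpa using hab)).1)
          fun a b hab => (h _ _ (hagree y a b) (by simpa using hab)).2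
      · exact Antitone.monovary (fun a b hab => (h _ _ (hagree x a b) (by simpa using hab)).1)
          fun a b hab => (h _ _ (hagree y a b) (by simpa using hab)).2
    refine le_trans ?_ (ih hF)
    rw [pow_succ, mul_assoc, Finset.mul_sum]
    refine mul_le_mul_of_nonneg_left (Finset.sum_le_sum fun π _ => ?_) (by positivity)
    exact card_mul_sum_perm_mul_le (hmono _ _) hrs

theorem card_pow_mul_sum_perm_family_le {ι : Type*} [Fintype ι] [DecidableEq ι] {t : ℕ}
    {r s : Fin t} (hrs : r ≠ s) {f g : (ι → Fin t) → ℝ} (hfg : Comonotone f g) :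
    (Fintype.card (Equiv.Perm (Fin t)) : ℝ) ^ Fintype.card ι *
        ∑ π : ι → Equiv.Perm (Fin t), f (fun i => π i r) * g (fun i => π i s) ≤
      (∑ π : ι → Equiv.Perm (Fin t), f fun i => π i r) *
        ∑ π : ι → Equiv.Perm (Fin t), g fun i => π i s := by
  let e := Fintype.equivFin ι
  have hsum : ∀ F : (ι → Equiv.Perm (Fin t)) → ℝ,
      ∑ π, F π = ∑ π : Fin (Fintype.card ι) → Equiv.Perm (Fin t), F fun i => π (e i) := fun F =>
    ((e.symm.arrowCongr (Equiv.refl (Equiv.Perm (Fin t)))).sum_comp F).symm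
  simp only [hsum]
  refine card_pow_mul_sum_tuple_mul_le hrs (Fintype.card ι)
    (f := fun x => f fun i => x (e i)) (g := fun x => g fun i => x (e i)) fun i => ?_
  have hagree : ∀ x y : Fin (Fintype.card ι) → Fin t, (∀ j, j ≠ i → x j = y j) →
      ∀ j, j ≠ e.symm i → x (e j) = y (e j) := fun x y h j hj =>
    h _ fun he => hj (by rw [← he, e.symm_apply_apply])
  exact (hfg (e.symm i)).imp (fun h x y hxy hi => h _ _ (hagree x y hxy) (by simpa using hi))
    fun h x y hxy hi => h _ _ (hagree x y hxy) (by simpa using hi)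

/-! ### Product measures and finite conditioning -/

theorem indepFun_pi_eval {ι E : Type*} [Fintype ι] [MeasurableSpace E] {μ : ι → Measure E}
    [∀ i, IsProbabilityMeasure (μ i)] {i j : ι} (hij : i ≠ j) :
    IndepFun (fun x : ι → E => x i) (fun x => x j) (Measure.pi μ) :=
  (iIndepFun_pi (μ := μ) (X := fun _ => id) fun _ => aemeasurable_id).indepFun hij

theorem map_pi_eval {ι E : Type*} [Fintype ι] [MeasurableSpace E] (μ : ι → Measure E)
    [∀ i, IsProbabilityMeasure (μ i)] (i : ι) :
    (Measure.pi μ).map (fun x => x i) = μ i :=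
  (measurePreserving_eval μ i).map_eq

theorem integrable_comp_eval_mul {ι E : Type*} [Fintype ι] [MeasurableSpace E]
    {μ : ι → Measure E} [∀ i, IsProbabilityMeasure (μ i)] {i j : ι} (hij : i ≠ j)
    {f g : E → ℝ} (hf : Integrable f (μ i)) (hg : Integrable g (μ j)) :
    Integrable (fun x : ι → E => f (x i) * g (x j)) (Measure.pi μ) := by
  have h := (indepFun_pi_eval (μ := μ) hij).comp₀ (φ := f) (ψ := g)
    (measurable_pi_apply i).aemeasurable (measurable_pi_apply j).aemeasurable
    (by rw [map_pi_eval]; exact hf.aemeasurable) (by rw [map_pi_eval]; exact hg.aemeasurable)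
  exact h.integrable_mul (integrable_comp_eval hf) (integrable_comp_eval hg)

theorem integral_comp_eval_mul {ι E : Type*} [Fintype ι] [MeasurableSpace E]
    {μ : ι → Measure E} [∀ i, IsProbabilityMeasure (μ i)] {i j : ι} (hij : i ≠ j)
    {f g : E → ℝ} (hf : AEStronglyMeasurable f (μ i)) (hg : AEStronglyMeasurable g (μ j)) :
    ∫ x : ι → E, f (x i) * g (x j) ∂Measure.pi μ = (∫ x, f x ∂μ i) * ∫ x, g x ∂μ j := by
  rw [(indepFun_pi_eval (μ := μ) hij).integral_fun_comp_mul_comp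
    (measurable_pi_apply i).aemeasurable (measurable_pi_apply j).aemeasurable
    (by rwa [map_pi_eval]) (by rwa [map_pi_eval]), integral_comp_eval hf, integral_comp_eval hg]

theorem integrable_of_comp_eval {t : ℕ} {E : Type*} [MeasurableSpace E] {μ : Measure E}
    [IsProbabilityMeasure μ] {r : Fin t} {f : E → ℝ}
    (hf : Integrable (fun x : Fin t → E => f (x r)) (Measure.pi fun _ => μ)) :
    Integrable f μ := by
  obtain _ | t := t
  · exact r.elim0
  -- Split off coordinate `r`: a function of the first factor of a product is integrable only if it
  -- is integrable on that factor.
  have h := ((measurePreserving_piFinSuccAbove (fun _ : Fin (t + 1) => μ) r).symm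
    _).integrable_comp_of_integrable hf
  have h' : Integrable (fun z : E × (Fin t → E) => f z.1)
      (μ.prod (Measure.pi fun _ : Fin t => μ)) := by
    refine h.congr (.of_forall fun z => ?_)
    change f (Fin.insertNth (α := fun _ => E) r z.1 z.2 r) = f z.1
    rw [Fin.insertNth_apply_same]
  exact h'.of_comp_fst (IsProbabilityMeasure.ne_zero _)

theorem uniformPerm_singleton (p : ℕ) (σ : Equiv.Perm (Fin p)) :
    uniformPerm p {σ} = (Fintype.card (Equiv.Perm (Fin p)) : ENNReal)⁻¹ := by
  rw [uniformPerm, PMF.toMeasure_apply_singleton _ _ (measurableSet_singleton σ),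
    PMF.uniformOfFintype_apply]

theorem pi_singleton_ne_zero {ι E : Type*} [Fintype ι] [MeasurableSpace E] {μ : ι → Measure E}
    [∀ i, SigmaFinite (μ i)] (h : ∀ i x, μ i {x} ≠ 0) (x : ι → E) : Measure.pi μ {x} ≠ 0 := by
  rw [Measure.pi_singleton]
  exact Finset.prod_ne_zero_iff.2 fun i _ => h i (x i)

theorem uniformPerm_singleton_ne_zero (p : ℕ) (σ : Equiv.Perm (Fin p)) :
    uniformPerm p {σ} ≠ 0 := by
  rw [uniformPerm_singleton]
  exact ENNReal.inv_ne_zero.2 (ENNReal.natCast_ne_top _)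

/-- When every point of the first factor has positive mass, the sections of an integrable function
are integrable everywhere instead of almost everywhere. -/
theorem forall_integrable_section {α β : Type*} [MeasurableSpace α] [MeasurableSpace β]
    [Countable α] {μ : Measure α} {ν : Measure β} [SFinite μ] [SFinite ν]
    (hμ : ∀ a, μ {a} ≠ 0) {f : α × β → ℝ} (hf : Integrable f (μ.prod ν)) (a : α) :
    Integrable (fun b => f (a, b)) ν :=
  ae_iff_of_countable.1 hf.prod_right_ae a (hμ a)

theorem integrable_prod_of_forall_section {α β : Type*} [MeasurableSpace α] [MeasurableSpace β]
    [Finite α] [DiscreteMeasurableSpace α] {μ : Measure α} {ν : Measure β} [IsFiniteMeasure μ]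
    [SFinite ν] {f : α × β → ℝ} (hf : AEStronglyMeasurable f (μ.prod ν))
    (h : ∀ a, Integrable (fun b => f (a, b)) ν) : Integrable f (μ.prod ν) :=
  (integrable_prod_iff hf).2 ⟨.of_forall h, .of_finite⟩

/-! ### A single slice -/

/-- One batch of the design: `τ` are the column permutations of its Latin hypercube, `p k l` is the
position (counted from `0`) within `{t * l + 1, …, t * l + t}` that replaces the symbol `l + 1` in
column `k`, and `γ` are the shifts, indexed by row as in `slhBatches`. -/
noncomputable def slicedBatch {n m t : ℕ} (τ : Fin m → Equiv.Perm (Fin n))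
    (p : Fin m → Fin n → Fin t) (γ : Batch n m) : Batch n m :=
  fun i k => (((t * (τ k i : ℕ) + (p k (τ k i) : ℕ) + 1 : ℕ) : ℝ) - γ i k) / ((n : ℝ) * (t : ℝ))

theorem slhBatches_eq_slicedBatch {n m t : ℕ} (c : SLHChoices n m t) (r : Fin t) :
    slhBatches n m t c r = slicedBatch (c.1 r) (fun k l => c.2.1 k l r) (c.2.2 r) := rfl

/-- The matrix `Δ` of level shifts for which `slicedBatch τ p γ` has the form `(B - Θ) / n`. The
shift `γ`, which is attached to a row, is read at the row where the level `l` occurs. -/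
noncomputable def sliceShift {n m t : ℕ} (τ : Fin m → Equiv.Perm (Fin n))
    (p : Fin m → Fin n → Fin t) (γ : Batch n m) : Batch n m :=
  fun l k => ((t : ℝ) - 1 - (p k l : ℕ) + γ ((τ k).symm l) k) / t

theorem apply_slicedBatch {n m t : ℕ} (v : Batch n m → ℝ) (τ : Fin m → Equiv.Perm (Fin n))
    (p : Fin m → Fin n → Fin t) (γ : Batch n m) :
    v (slicedBatch τ p γ) = levelForm v τ (sliceShift τ p γ) := by
  unfold levelForm
  congr 1
  funext i k
  -- An entry of `p` witnesses `t ≠ 0`. The identity needs no assumption on `n`, as both sides are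
  -- divided by `n`.
  have ht : (t : ℝ) ≠ 0 := by
    have := (p k i).pos
    positivity
  simp only [slicedBatch, sliceShift, Equiv.symm_apply_apply]
  push_cast
  rw [mul_comm (n : ℝ), ← div_div]
  congr 1
  field_simp
  ring

theorem sliceShift_mem_Ico {n m t : ℕ} (τ : Fin m → Equiv.Perm (Fin n))
    (p : Fin m → Fin n → Fin t) {γ : Batch n m} (hγ : ∀ i k, γ i k ∈ Ico (0 : ℝ) 1)
    (l : Fin n) (k : Fin m) : sliceShift τ p γ l k ∈ Ico (0 : ℝ) 1 := by
  have ht : (0 : ℝ) < t := by exact_mod_cast (p k l).pos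
  have hp : ((p k l : ℕ) : ℝ) + 1 ≤ t := by exact_mod_cast (p k l).isLt
  have hp0 : (0 : ℝ) ≤ ((p k l : ℕ) : ℝ) := by positivity
  obtain ⟨h0, h1⟩ := hγ ((τ k).symm l) k
  exact ⟨div_nonneg (by linarith) ht.le, (div_lt_one ht).2 (by linarith)⟩

/-- The law of the shifts of one batch. -/
noncomputable abbrev shiftLaw (n m : ℕ) : Measure (Batch n m) :=
  Measure.pi fun _ : Fin n => Measure.pi fun _ : Fin m => uniformIco

theorem ae_shiftLaw_mem_Ico (n m : ℕ) :
    ∀ᵐ γ ∂shiftLaw n m, ∀ i k, γ i k ∈ Ico (0 : ℝ) 1 := by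
  refine ae_all_iff.2 fun i => ae_all_iff.2 fun k => ?_
  have h₀ : ∀ᵐ x ∂uniformIco, x ∈ Ico (0 : ℝ) 1 := ae_restrict_mem measurableSet_Ico
  have h₁ : ∀ᵐ x ∂(Measure.pi fun _ : Fin m => uniformIco), x k ∈ Ico (0 : ℝ) 1 :=
    (measurePreserving_eval (fun _ : Fin m => uniformIco) k).quasiMeasurePreserving.ae h₀
  exact (measurePreserving_eval (fun _ : Fin n => Measure.pi fun _ : Fin m => uniformIco)
    i).quasiMeasurePreserving.ae h₁

/-- The mean of `v` over the shifts of one batch, with its entries before shifting fixed. -/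
noncomputable def shiftMean {n m t : ℕ} (v : Batch n m → ℝ) (τ : Fin m → Equiv.Perm (Fin n))
    (p : Fin m → Fin n → Fin t) : ℝ :=
  ∫ γ, v (slicedBatch τ p γ) ∂shiftLaw n m

/-- The mean of `v` over the Latin hypercube and the shifts of one batch, as a function of the
positions `p` of this batch in the replacement permutations. -/
noncomputable def sliceMean {n m t : ℕ} (v : Batch n m → ℝ) (p : Fin m → Fin n → Fin t) : ℝ :=
  ∫ τ, shiftMean v τ p ∂Measure.pi fun _ : Fin m => uniformPerm n

theorem comonotone_sliceMean {n m t : ℕ} {v : Batch n m → ℝ} (hv : BatchMonotonic v)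
    (hint : ∀ (τ : Fin m → Equiv.Perm (Fin n)) (p : Fin m → Fin n → Fin t),
      Integrable (fun γ => v (slicedBatch τ p γ)) (shiftLaw n m)) :
    Comonotone (fun x : Fin m × Fin n → Fin t => sliceMean v fun k l => x (k, l))
      fun x => sliceMean v fun k l => x (k, l) := by
  -- The shifts `γ` are compared row by row with `τ` fixed, so they need no reindexing by levels.
  have hmean : ∀ p q : Fin m → Fin n → Fin t,
      (∀ τ γ, (∀ i k, γ i k ∈ Ico (0 : ℝ) 1) →
        levelForm v τ (sliceShift τ p γ) ≤ levelForm v τ (sliceShift τ q γ)) →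
      sliceMean v p ≤ sliceMean v q := by
    intro p q h
    refine integral_mono .of_finite .of_finite fun τ => integral_mono_ae (hint τ p) (hint τ q) ?_
    filter_upwards [ae_shiftLaw_mem_Ico n m] with γ hγ
    simpa only [apply_slicedBatch] using h τ γ hγ
  rintro ⟨k, l⟩
  have hoff : ∀ (x y : Fin m × Fin n → Fin t), (∀ j, j ≠ (k, l) → x j = y j) →
      ∀ τ γ i j, (i, j) ≠ (l, k) → sliceShift τ (fun k l => x (k, l)) γ i j =
        sliceShift τ (fun k l => y (k, l)) γ i j := by
    intro x y h τ γ i j hij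
    have : x (j, i) = y (j, i) := h _ fun e => hij (by
      rw [Prod.mk.injEq] at e ⊢
      exact e.symm)
    simp only [sliceShift, this]
  have hle : ∀ (x y : Fin m × Fin n → Fin t), x (k, l) ≤ y (k, l) → ∀ τ γ,
      sliceShift τ (fun k l => y (k, l)) γ l k ≤ sliceShift τ (fun k l => x (k, l)) γ l k := by
    intro x y h τ γ
    have h' : ((x (k, l) : ℕ) : ℝ) ≤ (y (k, l) : ℕ) := by exact_mod_cast h
    simp only [sliceShift]
    gcongr
  rcases hv l k with h | h
  · refine Or.inr fun x y hxy hi => ?_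
    have := hmean (fun k l => y (k, l)) (fun k l => x (k, l)) fun τ γ hγ =>
      h τ _ _ (sliceShift_mem_Ico τ _ hγ) (sliceShift_mem_Ico τ _ hγ)
        (fun i j hij => (hoff x y hxy τ γ i j hij).symm) (hle x y hi τ γ)
    exact ⟨this, this⟩
  · refine Or.inl fun x y hxy hi => ?_
    have := hmean (fun k l => x (k, l)) (fun k l => y (k, l)) fun τ γ hγ =>
      h τ _ _ (sliceShift_mem_Ico τ _ hγ) (sliceShift_mem_Ico τ _ hγ)
        (fun i j hij => (hoff x y hxy τ γ i j hij).symm) (hle x y hi τ γ)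
    exact ⟨this, this⟩

/-! ### Averaging over the replacement permutations -/

/-- The law of the permutations of the replacement step. -/
noncomputable abbrev replacementLaw (n m t : ℕ) : Measure (Fin m → Fin n → Equiv.Perm (Fin t)) :=
  Measure.pi fun _ : Fin m => Measure.pi fun _ : Fin n => uniformPerm t

theorem integral_replacementLaw {n m t : ℕ} (F : (Fin m → Fin n → Equiv.Perm (Fin t)) → ℝ) :
    ∫ π, F π ∂replacementLaw n m t =
      ((Fintype.card (Equiv.Perm (Fin t)) : ℝ) ^ Fintype.card (Fin m × Fin n))⁻¹ *
        ∑ π : Fin m × Fin n → Equiv.Perm (Fin t), F fun k l => π (k, l) := by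
  rw [integral_fintype .of_finite]
  have hw : ∀ π, (replacementLaw n m t).real {π} =
      ((Fintype.card (Equiv.Perm (Fin t)) : ℝ) ^ Fintype.card (Fin m × Fin n))⁻¹ := by
    intro π
    simp [Measure.real, replacementLaw, Measure.pi_singleton, uniformPerm_singleton, ← pow_mul,
      mul_comm]
  simp only [hw, smul_eq_mul]
  rw [← Finset.mul_sum, ← (Equiv.curry (Fin m) (Fin n) (Equiv.Perm (Fin t))).sum_comp]
  rfl

theorem integral_sliceMean_mul_le {n m t : ℕ} {v : Batch n m → ℝ} (hv : BatchMonotonic v)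
    (hint : ∀ (τ : Fin m → Equiv.Perm (Fin n)) (p : Fin m → Fin n → Fin t),
      Integrable (fun γ => v (slicedBatch τ p γ)) (shiftLaw n m)) {r s : Fin t} (hrs : r ≠ s) :
    ∫ π, sliceMean v (fun k l => π k l r) * sliceMean v (fun k l => π k l s)
        ∂replacementLaw n m t ≤
      (∫ π, sliceMean v (fun k l => π k l r) ∂replacementLaw n m t) *
        ∫ π, sliceMean v (fun k l => π k l s) ∂replacementLaw n m t := by
  have h := card_pow_mul_sum_perm_family_le hrs (comonotone_sliceMean hv hint)
  simp only [integral_replacementLaw]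
  set K := (Fintype.card (Equiv.Perm (Fin t)) : ℝ) ^ Fintype.card (Fin m × Fin n) with hK
  have hK0 : 0 < K := by rw [hK]; positivity
  have h' := mul_le_mul_of_nonneg_left h (inv_nonneg.2 (mul_nonneg hK0.le hK0.le))
  refine le_of_eq_of_le ?_ (h'.trans_eq ?_)
  · field_simp
  · rw [mul_inv]; ring

/-! ### Conditioning on the replacement permutations -/

theorem exists_perm_family {n m t : ℕ} (r : Fin t) (p : Fin m → Fin n → Fin t) :
    ∃ π : Fin m → Fin n → Equiv.Perm (Fin t), (fun k l => π k l r) = p :=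
  ⟨fun k l => Equiv.swap r (p k l), by simp⟩

/-- Every choice of the column permutations and of the positions of slice `r` has positive
probability, so `v` is integrable conditionally on each of them. -/
theorem integrable_apply_slicedBatch {n m t : ℕ} {v : Batch n m → ℝ} {r : Fin t}
    (hv : Integrable (fun c => v (slhBatches n m t c r)) (slhChoicesLaw n m t))
    (τ : Fin m → Equiv.Perm (Fin n)) (p : Fin m → Fin n → Fin t) :
    Integrable (fun γ => v (slicedBatch τ p γ)) (shiftLaw n m) := by
  obtain ⟨π, rfl⟩ := exists_perm_family r p
  have h₁ := forall_integrable_section (fun a => pi_singleton_ne_zero (fun _ =>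
    pi_singleton_ne_zero fun _ => uniformPerm_singleton_ne_zero n) a) hv fun _ => τ
  have h₂ := forall_integrable_section (fun a => pi_singleton_ne_zero (fun _ =>
    pi_singleton_ne_zero fun _ => uniformPerm_singleton_ne_zero t) a) h₁ π
  exact integrable_of_comp_eval h₂

theorem integral_slhChoicesLaw {n m t : ℕ} {F : SLHChoices n m t → ℝ}
    (hF : Integrable F (slhChoicesLaw n m t)) :
    ∫ c, F c ∂slhChoicesLaw n m t =
      ∫ π, ∫ τ, ∫ γ, F (τ, π, γ) ∂(Measure.pi fun _ : Fin t => shiftLaw n m)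
        ∂(Measure.pi fun _ : Fin t => Measure.pi fun _ : Fin m => uniformPerm n)
        ∂replacementLaw n m t := by
  have hsec := forall_integrable_section (fun a => pi_singleton_ne_zero (fun _ =>
    pi_singleton_ne_zero fun _ => uniformPerm_singleton_ne_zero n) a) hF
  rw [slhChoicesLaw, integral_prod _ hF]
  refine (integral_congr_ae (.of_forall fun τ => integral_prod _ (hsec τ))).trans ?_
  exact integral_integral_swap .of_finite

/-- The mean of `v (D_r)` is obtained by conditioning on the replacement permutations: given these,
its mean is `sliceMean v` at the positions of slice `r`. -/
theorem integral_apply_slhBatches {n m t : ℕ} {v : Batch n m → ℝ} {r : Fin t}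
    (hv : Integrable (fun c => v (slhBatches n m t c r)) (slhChoicesLaw n m t)) :
    ∫ c, v (slhBatches n m t c r) ∂slhChoicesLaw n m t =
      ∫ π, sliceMean v (fun k l => π k l r) ∂replacementLaw n m t := by
  rw [integral_slhChoicesLaw hv]
  simp only [slhBatches_eq_slicedBatch]
  refine integral_congr_ae (.of_forall fun π => ?_)
  have h : ∀ τ : Fin t → Fin m → Equiv.Perm (Fin n),
      ∫ γ : Fin t → Batch n m, v (slicedBatch (τ r) (fun k l => π k l r) (γ r))
        ∂(Measure.pi fun _ => shiftLaw n m) = shiftMean v (τ r) fun k l => π k l r := fun τ =>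
    integral_comp_eval (μ := fun _ : Fin t => shiftLaw n m)
      (integrable_apply_slicedBatch hv (τ r) _).aestronglyMeasurable
  simp only [h]
  exact integral_comp_eval
    (μ := fun _ : Fin t => Measure.pi fun _ : Fin m => uniformPerm n)
    (f := fun σ => shiftMean v σ fun k l => π k l r)
    Integrable.of_finite.aestronglyMeasurable

theorem integrable_mul_slhBatches {n m t : ℕ} {v : Batch n m → ℝ} {r s : Fin t} (hrs : r ≠ s)
    (hr : Integrable (fun c => v (slhBatches n m t c r)) (slhChoicesLaw n m t))
    (hs : Integrable (fun c => v (slhBatches n m t c s)) (slhChoicesLaw n m t)) :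
    Integrable (fun c => v (slhBatches n m t c r) * v (slhBatches n m t c s))
      (slhChoicesLaw n m t) := by
  have hγ : ∀ (τ : Fin t → Fin m → Equiv.Perm (Fin n))
      (π : Fin m → Fin n → Equiv.Perm (Fin t)),
      Integrable (fun γ : Fin t → Batch n m => v (slhBatches n m t (τ, π, γ) r) *
        v (slhBatches n m t (τ, π, γ) s)) (Measure.pi fun _ => shiftLaw n m) := fun τ π =>
    integrable_comp_eval_mul (μ := fun _ : Fin t => shiftLaw n m) hrs
      (integrable_apply_slicedBatch hr (τ r) fun k l => π k l r)
      (integrable_apply_slicedBatch hs (τ s) fun k l => π k l s)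
  have hne := fun a => pi_singleton_ne_zero (μ := fun _ : Fin t => Measure.pi fun _ : Fin m =>
    uniformPerm n) (fun _ => pi_singleton_ne_zero fun _ => uniformPerm_singleton_ne_zero n) a
  have hm := hr.aestronglyMeasurable.mul hs.aestronglyMeasurable
  refine integrable_prod_of_forall_section hm fun τ => ?_
  refine integrable_prod_of_forall_section
    ((forall_integrable_section hne hr τ).aestronglyMeasurable.mul
      (forall_integrable_section hne hs τ).aestronglyMeasurable) fun π => hγ τ π

/-- Given the replacement permutations, distinct batches are independent, so the conditional mean
of the product is a product. -/
theorem integral_mul_slhBatches {n m t : ℕ} {v : Batch n m → ℝ} {r s : Fin t} (hrs : r ≠ s)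
    (hr : Integrable (fun c => v (slhBatches n m t c r)) (slhChoicesLaw n m t))
    (hs : Integrable (fun c => v (slhBatches n m t c s)) (slhChoicesLaw n m t)) :
    ∫ c, v (slhBatches n m t c r) * v (slhBatches n m t c s) ∂slhChoicesLaw n m t =
      ∫ π, sliceMean v (fun k l => π k l r) * sliceMean v (fun k l => π k l s)
        ∂replacementLaw n m t := by
  rw [integral_slhChoicesLaw (integrable_mul_slhBatches hrs hr hs)]
  simp only [slhBatches_eq_slicedBatch]
  refine integral_congr_ae (.of_forall fun π => ?_)
  have h : ∀ τ : Fin t → Fin m → Equiv.Perm (Fin n),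
      ∫ γ : Fin t → Batch n m, v (slicedBatch (τ r) (fun k l => π k l r) (γ r)) *
          v (slicedBatch (τ s) (fun k l => π k l s) (γ s))
        ∂(Measure.pi fun _ => shiftLaw n m) =
      shiftMean v (τ r) (fun k l => π k l r) * shiftMean v (τ s) fun k l => π k l s := fun τ =>
    integral_comp_eval_mul (μ := fun _ : Fin t => shiftLaw n m) hrs
      (integrable_apply_slicedBatch hr (τ r) _).aestronglyMeasurable
      (integrable_apply_slicedBatch hs (τ s) _).aestronglyMeasurable
  simp only [h]
  exact integral_comp_eval_mul
    (μ := fun _ : Fin t => Measure.pi fun _ : Fin m => uniformPerm n) hrs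
    (f := fun σ => shiftMean v σ fun k l => π k l r)
    (g := fun σ => shiftMean v σ fun k l => π k l s)
    Integrable.of_finite.aestronglyMeasurable Integrable.of_finite.aestronglyMeasurable

/-! ### Distinct batches are not positively correlated -/

theorem integral_mul_le_of_batchMonotonic {n m t : ℕ} {Ω : Type*} [MeasurableSpace Ω]
    {P : Measure Ω} {D : Ω → Fin t → Batch n m} (hD : HasLaw D (slhLaw n m t) P)
    {v : Batch n m → ℝ} (hv : BatchMonotonic v)
    (hint : ∀ r, Integrable v (P.map fun ω => D ω r)) {r s : Fin t} (hrs : r ≠ s) :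
    Integrable (fun ω => v (D ω r) * v (D ω s)) P ∧
      ∫ ω, v (D ω r) * v (D ω s) ∂P ≤ (∫ ω, v (D ω r) ∂P) * ∫ ω, v (D ω s) ∂P := by
  have hb := measurable_slhBatches n m t
  have hlaw : ∀ r, Integrable (fun d : Fin t → Batch n m => v (d r)) (slhLaw n m t) := by
    intro r
    have h := hint r
    rw [← Function.comp_def (fun d : Fin t → Batch n m => d r) D,
      ← AEMeasurable.map_map_of_aemeasurable (measurable_pi_apply r).aemeasurable hD.aemeasurable,
      hD.map_eq] at h
    exact h.comp_measurable (measurable_pi_apply r)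
  have hc : ∀ r, Integrable (fun c => v (slhBatches n m t c r)) (slhChoicesLaw n m t) :=
    fun r => (hlaw r).comp_measurable hb
  have hmul : Integrable (fun d : Fin t → Batch n m => v (d r) * v (d s)) (slhLaw n m t) :=
    (integrable_map_measure ((hlaw r).aestronglyMeasurable.mul (hlaw s).aestronglyMeasurable)
      hb.aemeasurable).2 (integrable_mul_slhBatches hrs (hc r) (hc s))
  have htransfer : ∀ {F : (Fin t → Batch n m) → ℝ}, Integrable F (slhLaw n m t) →
      ∫ ω, F (D ω) ∂P = ∫ c, F (slhBatches n m t c) ∂slhChoicesLaw n m t := by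
    intro F hF
    refine (hD.integral_comp hF.aestronglyMeasurable).trans ?_
    exact integral_map hb.aemeasurable hF.aestronglyMeasurable
  refine ⟨?_, ?_⟩
  · have h := hmul
    rw [← hD.map_eq] at h
    exact h.comp_aemeasurable hD.aemeasurable
  · rw [htransfer hmul, htransfer (hlaw r), htransfer (hlaw s),
      integral_mul_slhBatches hrs (hc r) (hc s), integral_apply_slhBatches (hc r),
      integral_apply_slhBatches (hc s)]
    exact integral_sliceMean_mul_le hv (integrable_apply_slicedBatch (hc r)) hrs

theorem mainTheorem2 {n m t : ℕ} {Ω : Type*} [MeasurableSpace Ω] (P : Measure Ω)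
    (D : Ω → Fin t → Batch n m) (hD : HasLaw D (slhLaw n m t) P) :
    -- every monotonic function `v` of a batch for which the expectations exist
    (∀ v : Batch n m → ℝ, BatchMonotonic v →
      (∀ r, Integrable v (P.map fun ω => D ω r)) →
      ∀ r s : Fin t, r ≠ s →
        Integrable (fun ω => v (D ω r) * v (D ω s)) P ∧
        ∫ ω, v (D ω r) * v (D ω s) ∂P ≤ (∫ ω, v (D ω r) ∂P) * ∫ ω, v (D ω s) ∂P) ∧
    -- in particular the optimal value of the sample-average approximation problem
    (∀ (p : ℕ) (X : Set (EuclideanSpace ℝ (Fin p)))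
      (G : EuclideanSpace ℝ (Fin p) → (Fin m → ℝ) → ℝ),
      (∀ B ∈ unitBatches n m, ∃ x ∈ X, IsMinOn (saaObjective G B) X x) →
      BatchMonotonic (saaValue (n := n) X G) →
      (∀ r, Integrable (saaValue X G) (P.map fun ω => D ω r)) →
      ∀ r s : Fin t, r ≠ s →
        Integrable (fun ω => saaValue X G (D ω r) * saaValue X G (D ω s)) P ∧
        ∫ ω, saaValue X G (D ω r) * saaValue X G (D ω s) ∂P ≤
          (∫ ω, saaValue X G (D ω r) ∂P) * ∫ ω, saaValue X G (D ω s) ∂P) :=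
  ⟨fun _ hv hint _ _ hrs => integral_mul_le_of_batchMonotonic hD hv hint hrs,
    fun _ _ _ _ hv hint _ _ hrs => integral_mul_le_of_batchMonotonic hD hv hint hrs⟩
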